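/- Let $N\ge 1$, let $\Omega\subset\mathbb R^N$ be a bounded open set, let $x_0\in\Omega$, $s\in(\tfrac12,1)$ and $p>p_*:=\frac{N}{N-2s+1}$. For a continuous function $\phi$ with support in $\overline\Omega$ put $$(-\Delta)^s_\varepsilon\phi(x)=\int_{|x-y|\ge\varepsilon}\frac{\phi(x)-\phi(y)}{|x-y|^{N+2s}}\,dy,\qquad (-\Delta)^s\phi(x)=\lim_{\varepsilon\to0^+}(-\Delta)^s_\varepsilon\phi(x),$$ and let $\mathbb X_s(\Omega)$ be the set of all $\phi\in C(\mathbb R^N)$ with $\operatorname{supp}\phi\subset\overline\Omega$ such that $(-\Delta)^s\phi(x)$ exists for every $x\in\Omega$ and is bounded on $\Omega$, and such that, for some $\varepsilon_0>0$ and some $g\in L^1(\Omega,\operatorname{dist}(x,\mathbb R^N\setminus\Omega)^s\,dx)$, one has $|(-\Delta)^s_\varepsilon\phi|\le g$ a.e. in $\Omega$ for all $\varepsilon\in(0,\varepsilon_0)$. A function $u$ is a (distributional) solution of $$(-\Delta)^su+|\nabla u|^p=\delta_{x_0}\ \text{ in }\Omega,\qquad u=0\ \text{ in }\mathbb R^N\setminus\Omega,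 \qquad (1)$$ if $u\in L^1(\Omega)$, $u$ has a weak gradient in $\Omega$ with $|\nabla u|^p\in L^1_{loc}(\Omega)$, $u=0$ a.e. in $\mathbb R^N\setminus\Omega$, and for every $\phi\in\mathbb X_s(\Omega)$ the function $\phi|\nabla u|^p$ is integrable on $\Omega$ and $$\int_\Omega u\,(-\Delta)^s\phi\,dx+\int_\Omega\phi\,|\nabla u|^p\,dx=\phi(x_0).$$ Then problem (1) has no solution $u$ with $u\in W^{1,p}_0(\Omega)$, the closure of $C_c^\infty(\Omega)$ in $W^{1,p}(\Omega)$. -/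

import Mathlib

open Set Filter Topology MeasureTheory
open scoped ContDiff

noncomputable section

namespace FracHJ

/-- The critical exponent `p_* = N / (N - 2 s + 1)`. -/
def criticalExponent (N : ℕ) (s : ℝ) : ℝ := (N : ℝ) / ((N : ℝ) - 2 * s + 1)

/-- Functions of class `C_c^∞(Ω)`, extended by zero to the whole space. -/
structure IsTestFunction {N : ℕ} (Ω : Set (EuclideanSpace ℝ (Fin N)))
    (φ : EuclideanSpace ℝ (Fin N) → ℝ) : Prop where
  contDiff : ContDiff ℝ ∞ φ
  hasCompactSupport : HasCompactSupport φ
  tsupport_subset : tsupport φ ⊆ Ω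

/-- `G` is the weak (distributional) gradient of `u` in the open set `Ω`. -/
structure IsWeakGradient {N : ℕ} (Ω : Set (EuclideanSpace ℝ (Fin N)))
    (u : EuclideanSpace ℝ (Fin N) → ℝ)
    (G : EuclideanSpace ℝ (Fin N) → EuclideanSpace ℝ (Fin N)) : Prop where
  locallyIntegrableOn_fun : LocallyIntegrableOn u Ω
  locallyIntegrableOn_grad : LocallyIntegrableOn G Ω
  integral_eq : ∀ φ : EuclideanSpace ℝ (Fin N) → ℝ, IsTestFunction Ω φ →
    ∀ v : EuclideanSpace ℝ (Fin N),
      ∫ x in Ω, u x * fderiv ℝ φ x v = -∫ x in Ω, φ x * inner ℝ (G x) v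

/-- `u ∈ W^{1,p}_0(Ω)`: `u` belongs to `W^{1,p}(Ω)` and is the limit, in the norm of `W^{1,p}(Ω)`,
of a sequence of functions in `C_c^∞(Ω)`. -/
def MemSobolevZero {N : ℕ} (Ω : Set (EuclideanSpace ℝ (Fin N))) (p : ℝ)
    (u : EuclideanSpace ℝ (Fin N) → ℝ) : Prop :=
  ∃ G : EuclideanSpace ℝ (Fin N) → EuclideanSpace ℝ (Fin N),
    IsWeakGradient Ω u G ∧
    MemLp u (ENNReal.ofReal p) (volume.restrict Ω) ∧
    MemLp G (ENNReal.ofReal p) (volume.restrict Ω) ∧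
    ∃ φ : ℕ → EuclideanSpace ℝ (Fin N) → ℝ,
      (∀ n, IsTestFunction Ω (φ n)) ∧
      Tendsto (fun n => eLpNorm (fun x => φ n x - u x) (ENNReal.ofReal p) (volume.restrict Ω))
        atTop (𝓝 0) ∧
      Tendsto (fun n => eLpNorm (fun x => gradient (φ n) x - G x) (ENNReal.ofReal p)
        (volume.restrict Ω)) atTop (𝓝 0)

/-- The truncated fractional Laplacian
`(-Δ)^s_ε φ(x) = ∫_{|x - y| ≥ ε} (φ(x) - φ(y)) / |x - y|^(N + 2 s) dy`. -/
def truncFracLaplacian {N : ℕ} (s ε : ℝ) (φ : EuclideanSpace ℝ (Fin N) → ℝ)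
    (x : EuclideanSpace ℝ (Fin N)) : ℝ :=
  ∫ y in {y | ε ≤ ‖x - y‖}, (φ x - φ y) / ‖x - y‖ ^ ((N : ℝ) + 2 * s)

/-- The fractional Laplacian `(-Δ)^s φ(x) = lim_{ε → 0+} (-Δ)^s_ε φ(x)`. It is only used where the
limit exists; see the field `tendsto` of `MemTestSpace`. -/
def fracLaplacian {N : ℕ} (s : ℝ) (φ : EuclideanSpace ℝ (Fin N) → ℝ)
    (x : EuclideanSpace ℝ (Fin N)) : ℝ :=
  limUnder (𝓝[>] (0 : ℝ)) fun ε => truncFracLaplacian s ε φ x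

/-- The test space `𝕏_s(Ω)`. -/
structure MemTestSpace {N : ℕ} (s : ℝ) (Ω : Set (EuclideanSpace ℝ (Fin N)))
    (φ : EuclideanSpace ℝ (Fin N) → ℝ) : Prop where
  continuous : Continuous φ
  tsupport_subset : tsupport φ ⊆ closure Ω
  /-- the fractional Laplacian exists at every point of `Ω` -/
  tendsto : ∀ x ∈ Ω, Tendsto (fun ε => truncFracLaplacian s ε φ x) (𝓝[>] 0)
    (𝓝 (fracLaplacian s φ x))
  /-- the fractional Laplacian is bounded in `Ω` -/
  bounded : ∃ C : ℝ, 0 < C ∧ ∀ x ∈ Ω, |fracLaplacian s φ x| ≤ C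
  /-- the truncations are dominated by a function in `L¹(Ω, δ^s dx)`, `δ(x) = dist(x, Ωᶜ)` -/
  dominated : ∃ g : EuclideanSpace ℝ (Fin N) → ℝ,
    IntegrableOn (fun x => g x * Metric.infDist x Ωᶜ ^ s) Ω ∧
    ∃ ε₀ : ℝ, 0 < ε₀ ∧ ∀ ε : ℝ, 0 < ε → ε < ε₀ →
      ∀ᵐ x ∂(volume.restrict Ω), |truncFracLaplacian s ε φ x| ≤ g x

/-- `u` is a distributional solution of `(-Δ)^s u + |∇u|^p = ν` in `Ω`, `u = 0` in `ℝ^N \ Ω`, for a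
measure `ν` on `ℝ^N` (of which only the restriction to `Ω` matters). -/
def IsDistributionalSolution {N : ℕ} (s p : ℝ) (Ω : Set (EuclideanSpace ℝ (Fin N)))
    (ν : Measure (EuclideanSpace ℝ (Fin N))) (u : EuclideanSpace ℝ (Fin N) → ℝ) : Prop :=
  IntegrableOn u Ω ∧
  (∀ᵐ x ∂(volume.restrict Ωᶜ), u x = 0) ∧
  ∃ G : EuclideanSpace ℝ (Fin N) → EuclideanSpace ℝ (Fin N),
    IsWeakGradient Ω u G ∧
    LocallyIntegrableOn (fun x => ‖G x‖ ^ p) Ω ∧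
    ∀ φ : EuclideanSpace ℝ (Fin N) → ℝ, MemTestSpace s Ω φ →
      IntegrableOn (fun x => φ x * ‖G x‖ ^ p) Ω ∧
      (∫ x in Ω, u x * fracLaplacian s φ x) + (∫ x in Ω, φ x * ‖G x‖ ^ p) = ∫ x in Ω, φ x ∂ν

end FracHJ

end

noncomputable section

namespace FracHJ

/-! Test the equation with cutoffs `η_r(x) = η((x - x₀)/r)`, where `η(0) = 1`. The right-hand side
is 1 for every small `r`, while both terms on the left tend to 0. The gradient term vanishes by
dominated convergence (`tendsto_integral_rescale_mul`).

For the other term, approximate `u` by `ψ ∈ C_c^∞(Ω)` and write the pairing of `ψ` with `(-Δ)^s η_r`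
as half the integral over `z` of `∫ (ψ(x+z) - ψ(x)) (η_r(x+z) - η_r(x)) dx / |z|^(N+2s)`. With `q`
the conjugate exponent of `p`, Hölder's inequality bounds the inner integral by `|z| ‖∇ψ‖_p` times a
multiple of `r^(N/q) min(1, |z|/r)`. Scaling in `z` gives the order `r^(N/q + 1 - 2s)`
(`MemSobolevZero.exists_abs_integral_mul_fracLaplacian_le`), and this exponent is positive exactly
when `p > p_*` (`scaling_exponent_pos`). -/

variable {N : ℕ}

/-! ### Second differences and their integrable majorant -/

/-- The kernel `|z| min(1, |z|) / |z|^(N + 2 s)`, which dominates the normalized second difference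
quotients of smooth compactly supported functions. -/
def levyKernel (s : ℝ) (z : EuclideanSpace ℝ (Fin N)) : ℝ :=
  ‖z‖ * min 1 ‖z‖ / ‖z‖ ^ ((N : ℝ) + 2 * s)

/-- The symmetric second difference of `φ` at `x`, with increment `z`. -/
def secondDiff (φ : EuclideanSpace ℝ (Fin N) → ℝ) (x z : EuclideanSpace ℝ (Fin N)) : ℝ :=
  2 * φ x - φ (x - z) - φ (x + z)

/-- The fractional Laplacian, written as an absolutely convergent integral of second differences. -/
def symFracLaplacian (s : ℝ) (φ : EuclideanSpace ℝ (Fin N) → ℝ)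
    (x : EuclideanSpace ℝ (Fin N)) : ℝ :=
  (1 / 2) * ∫ z, secondDiff φ x z / ‖z‖ ^ ((N : ℝ) + 2 * s)

theorem levyKernel_nonneg (s : ℝ) (z : EuclideanSpace ℝ (Fin N)) : 0 ≤ levyKernel s z := by
  unfold levyKernel; positivity

/-- In polar coordinates the radial integrand is `min(1, t) t^(-2s)`: near 0 it is `t^(1-2s)`,
integrable as `s < 1`, and at infinity `t^(-2s)`, integrable as `s > 1/2`. -/
theorem integrable_levyKernel (hN : 1 ≤ N) {s : ℝ} (hs : 1 / 2 < s) (hs1 : s < 1) :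
    Integrable (levyKernel (N := N) s) := by
  have : Nonempty (Fin N) := ⟨⟨0, hN⟩⟩
  have key := integrable_fun_norm_addHaar (E := EuclideanSpace ℝ (Fin N)) volume
    (f := fun t : ℝ => t * min 1 t / t ^ ((N : ℝ) + 2 * s))
  refine key.2 ?_
  rw [finrank_euclideanSpace_fin]
  have pw : ∀ t : ℝ, 0 < t → t ^ (N - 1) • (t * min 1 t / t ^ ((N : ℝ) + 2 * s))
      = min 1 t * t ^ (-(2 * s)) := by
    intro t ht
    have h1 : t ^ (N - 1) * t = t ^ (N : ℝ) := by
      rw [Real.rpow_natCast, ← pow_succ, Nat.sub_add_cancel hN]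
    have h2 : 0 < t ^ (N : ℝ) := Real.rpow_pos_of_pos ht _
    have h3 : 0 < t ^ (2 * s) := Real.rpow_pos_of_pos ht _
    rw [Real.rpow_add ht, Real.rpow_neg ht.le, smul_eq_mul]
    have : t ^ (N - 1) * (t * min 1 t / (t ^ (N : ℝ) * t ^ (2 * s)))
      = (t ^ (N - 1) * t) * min 1 t / (t ^ (N : ℝ) * t ^ (2 * s)) := by ring
    rw [this, h1]
    field_simp
  rw [← Ioc_union_Ioi_eq_Ioi (zero_le_one (α := ℝ)), integrableOn_union]
  constructor
  · have h : IntegrableOn (fun t : ℝ => t ^ (1 - 2 * s)) (Ioc 0 1) := by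
      have := intervalIntegral.intervalIntegrable_rpow' (a := 0) (b := 1)
        (r := 1 - 2 * s) (by linarith)
      exact (intervalIntegrable_iff_integrableOn_Ioc_of_le zero_le_one).1 this
    refine h.congr_fun (fun t ht => ?_) measurableSet_Ioc
    rw [pw t ht.1, min_eq_right ht.2]
    simp only []
    rw [sub_eq_add_neg, Real.rpow_add ht.1, Real.rpow_one]
  · have h : IntegrableOn (fun t : ℝ => t ^ (-(2 * s))) (Ioi 1) :=
      integrableOn_Ioi_rpow_of_lt (by linarith) one_pos
    refine h.congr_fun (fun t ht => ?_) measurableSet_Ioi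
    have ht' : (1 : ℝ) < t := ht
    rw [pw t (by linarith), min_eq_left ht'.le, one_mul]

theorem IsTestFunction.continuous {Ω : Set (EuclideanSpace ℝ (Fin N))}
    {φ : EuclideanSpace ℝ (Fin N) → ℝ} (h : IsTestFunction Ω φ) : Continuous φ :=
  h.contDiff.continuous

theorem IsTestFunction.exists_bound {Ω : Set (EuclideanSpace ℝ (Fin N))}
    {φ : EuclideanSpace ℝ (Fin N) → ℝ} (h : IsTestFunction Ω φ) :
    ∃ M : ℝ, 0 ≤ M ∧ ∀ x, |φ x| ≤ M := by
  obtain ⟨M, hM⟩ := h.continuous.bounded_above_of_compact_support h.hasCompactSupport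
  exact ⟨M, (norm_nonneg _).trans (hM 0), hM⟩

/-- Mean value inequality on `[0, 1]` for `t ↦ φ(x - tz) + φ(x + tz)`: its derivative is a
difference of `Dφ` at two points `2t|z|` apart, applied to `z`. -/
theorem abs_secondDiff_le_of_lipschitzWith_fderiv {φ : EuclideanSpace ℝ (Fin N) → ℝ}
    (hφ : Differentiable ℝ φ) {K : NNReal} (hK : LipschitzWith K (fderiv ℝ φ))
    (x z : EuclideanSpace ℝ (Fin N)) : |secondDiff φ x z| ≤ 2 * K * ‖z‖ ^ 2 := by
  have hd : ∀ t : ℝ, HasDerivAt (fun t : ℝ => φ (x - t • z) + φ (x + t • z))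
      (fderiv ℝ φ (x - t • z) (-z) + fderiv ℝ φ (x + t • z) z) t := by
    intro t
    have h0 : HasDerivAt (fun t : ℝ => t • z) z t := by
      simpa using (hasDerivAt_id t).smul_const z
    exact ((hφ _).hasFDerivAt.comp_hasDerivAt t (h0.const_sub x)).add
      ((hφ _).hasFDerivAt.comp_hasDerivAt t (h0.const_add x))
  have hb := norm_image_sub_le_of_norm_deriv_le_segment_01' (C := 2 * K * ‖z‖ ^ 2)
    (fun t _ => (hd t).hasDerivWithinAt) (fun t ht => by
      have e : fderiv ℝ φ (x - t • z) (-z) + fderiv ℝ φ (x + t • z) z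
          = (fderiv ℝ φ (x + t • z) - fderiv ℝ φ (x - t • z)) z := by
        simp only [map_neg, sub_apply]; ring
      rw [e]
      refine (ContinuousLinearMap.le_opNorm _ _).trans ?_
      have h1 := hK.norm_sub_le (x + t • z) (x - t • z)
      have h2 : x + t • z - (x - t • z) = (2 * t) • z := by module
      rw [h2, norm_smul, Real.norm_of_nonneg (by linarith [ht.1])] at h1
      have h3 : (K : ℝ) * (2 * t * ‖z‖) ≤ 2 * K * ‖z‖ := by
        have : (K : ℝ) * ‖z‖ * t ≤ K * ‖z‖ * 1 := by
          gcongr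
          exact ht.2.le
        linarith
      calc _ ≤ (2 * K * ‖z‖) * ‖z‖ := by gcongr; exact h1.trans h3
        _ = _ := by ring)
  have e : ((φ (x - (1 : ℝ) • z) + φ (x + (1 : ℝ) • z))
      - (φ (x - (0 : ℝ) • z) + φ (x + (0 : ℝ) • z))) = -secondDiff φ x z := by
    simp only [secondDiff, one_smul, zero_smul, sub_zero, add_zero]; ring
  rw [e, norm_neg, Real.norm_eq_abs] at hb
  exact hb

theorem IsTestFunction.exists_abs_secondDiff_le {Ω : Set (EuclideanSpace ℝ (Fin N))}
    {φ : EuclideanSpace ℝ (Fin N) → ℝ} (h : IsTestFunction Ω φ) :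
    ∃ C : ℝ, 0 ≤ C ∧ ∀ x z, |secondDiff φ x z| ≤ C * (‖z‖ * min 1 ‖z‖) := by
  obtain ⟨M, hM0, hM⟩ := h.exists_bound
  obtain ⟨K, hK⟩ := (h.contDiff.fderiv_right (m := 1) (by norm_cast)
    ).lipschitzWith_of_hasCompactSupport (𝕂 := ℝ) (h.hasCompactSupport.fderiv ℝ) one_ne_zero
  -- `2K` serves the quadratic bound for `|z| ≤ 1`; `4M` serves the trivial bound for `|z| ≥ 1`.
  refine ⟨2 * K + 4 * M, by positivity, fun x z => ?_⟩
  have hK0 : (0 : ℝ) ≤ K := K.2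
  rcases le_total ‖z‖ 1 with hz | hz
  · rw [min_eq_right hz]
    refine (abs_secondDiff_le_of_lipschitzWith_fderiv
      (h.contDiff.differentiable (by simp)) hK x z).trans ?_
    rw [← sq]
    gcongr
    linarith
  · rw [min_eq_left hz, mul_one]
    have h1 : |secondDiff φ x z| ≤ 4 * M := by
      have a := abs_le.1 (hM x)
      have b := abs_le.1 (hM (x - z))
      have c := abs_le.1 (hM (x + z))
      unfold secondDiff
      exact abs_le.2 ⟨by linarith, by linarith⟩
    calc _ ≤ 4 * M := h1
      _ ≤ 2 * K + 4 * M := by linarith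
      _ ≤ _ := le_mul_of_one_le_right (by positivity) hz

theorem abs_secondDiff_div_le {φ : EuclideanSpace ℝ (Fin N) → ℝ} {C : ℝ}
    (hC : ∀ x z, |secondDiff φ x z| ≤ C * (‖z‖ * min 1 ‖z‖)) (s : ℝ)
    (x z : EuclideanSpace ℝ (Fin N)) :
    ‖secondDiff φ x z / ‖z‖ ^ ((N : ℝ) + 2 * s)‖ ≤ C * levyKernel s z := by
  rw [norm_div, Real.norm_eq_abs, Real.norm_of_nonneg (by positivity), levyKernel,
    ← mul_div_assoc]
  exact div_le_div_of_nonneg_right (hC x z) (by positivity)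

theorem measurable_norm_rpow (a : ℝ) :
    Measurable fun z : EuclideanSpace ℝ (Fin N) => ‖z‖ ^ a :=
  measurable_norm.pow_const a

theorem continuous_secondDiff {φ : EuclideanSpace ℝ (Fin N) → ℝ} (hφ : Continuous φ)
    (x : EuclideanSpace ℝ (Fin N)) : Continuous (secondDiff φ x) := by
  unfold secondDiff; fun_prop

theorem integrable_secondDiff_div (hN : 1 ≤ N) {s : ℝ} (hs : 1 / 2 < s) (hs1 : s < 1)
    {φ : EuclideanSpace ℝ (Fin N) → ℝ} (hφ : Continuous φ) {C : ℝ}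
    (hC : ∀ x z, |secondDiff φ x z| ≤ C * (‖z‖ * min 1 ‖z‖)) (x : EuclideanSpace ℝ (Fin N)) :
    Integrable fun z => secondDiff φ x z / ‖z‖ ^ ((N : ℝ) + 2 * s) :=
  ((integrable_levyKernel hN hs hs1).const_mul C).mono'
    ((continuous_secondDiff hφ x).measurable.div (measurable_norm_rpow _)).aestronglyMeasurable
    (Eventually.of_forall (abs_secondDiff_div_le hC s x))

/-! ### The fractional Laplacian of smooth functions -/

theorem measurableSet_le_norm (ε : ℝ) :
    MeasurableSet {z : EuclideanSpace ℝ (Fin N) | ε ≤ ‖z‖} :=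
  measurableSet_le measurable_const measurable_norm

theorem integrableOn_div_norm_rpow (hN : 1 ≤ N) {s : ℝ} (hs : 1 / 2 < s) (hs1 : s < 1) {ε : ℝ}
    (hε : 0 < ε) {f : EuclideanSpace ℝ (Fin N) → ℝ} (hf : Continuous f) {M : ℝ}
    (hM : ∀ z, |f z| ≤ M) :
    IntegrableOn (fun z => f z / ‖z‖ ^ ((N : ℝ) + 2 * s))
      {z : EuclideanSpace ℝ (Fin N) | ε ≤ ‖z‖} := by
  -- Away from the ball of radius `ε` the numerator of `levyKernel` is at least this constant.
  have hc : 0 < ε * min 1 ε := by positivity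
  refine (((integrable_levyKernel hN hs hs1).const_mul
    (M / (ε * min 1 ε))).integrableOn).mono'
    (hf.measurable.div (measurable_norm_rpow _)).aestronglyMeasurable ?_
  refine (ae_restrict_iff' (measurableSet_le_norm ε)).2 (Eventually.of_forall fun z hz => ?_)
  have hz' : ε ≤ ‖z‖ := hz
  have hM0 : 0 ≤ M := (abs_nonneg _).trans (hM 0)
  rw [norm_div, Real.norm_eq_abs, Real.norm_of_nonneg (by positivity), levyKernel,
    ← mul_div_assoc]
  refine div_le_div_of_nonneg_right ((hM z).trans ?_) (by positivity)
  rw [div_mul_eq_mul_div, le_div_iff₀ hc]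
  gcongr

/-- Substituting `y = x - z` and `y = x + z` gives two expressions for the same integral; their
average contains the second difference. -/
theorem truncFracLaplacian_eq (hN : 1 ≤ N) {s : ℝ} (hs : 1 / 2 < s) (hs1 : s < 1) {ε : ℝ}
    (hε : 0 < ε) {φ : EuclideanSpace ℝ (Fin N) → ℝ} (hφ : Continuous φ) {M : ℝ}
    (hM : ∀ z, |φ z| ≤ M) (x : EuclideanSpace ℝ (Fin N)) :
    truncFracLaplacian s ε φ x = (1 / 2) * ∫ z in {z : EuclideanSpace ℝ (Fin N) | ε ≤ ‖z‖},
      secondDiff φ x z / ‖z‖ ^ ((N : ℝ) + 2 * s) := by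
  set a : ℝ := (N : ℝ) + 2 * s
  set S : Set (EuclideanSpace ℝ (Fin N)) := {z | ε ≤ ‖z‖} with hS
  have hSm : MeasurableSet S := measurableSet_le_norm ε
  have hbd : ∀ y y', |φ y - φ y'| ≤ 2 * M := fun y y' => by
    have b := abs_le.1 (hM y)
    have c := abs_le.1 (hM y')
    exact abs_le.2 ⟨by linarith, by linarith⟩
  have h1 : truncFracLaplacian s ε φ x = ∫ z in S, (φ x - φ (x - z)) / ‖z‖ ^ a := by
    rw [← integral_indicator hSm, ← integral_sub_left_eq_self _ volume x, truncFracLaplacian,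
      ← integral_indicator (by
        exact measurableSet_le measurable_const (by fun_prop))]
    refine integral_congr_ae (Eventually.of_forall fun y => ?_)
    simp only [indicator, mem_ofPred_eq, hS, sub_sub_cancel]
    rfl
  have h2 : truncFracLaplacian s ε φ x = ∫ z in S, (φ x - φ (x + z)) / ‖z‖ ^ a := by
    rw [h1, ← integral_indicator hSm, ← integral_indicator hSm, ← integral_neg_eq_self]
    refine integral_congr_ae (Eventually.of_forall fun y => ?_)
    simp only [indicator, mem_ofPred_eq, hS, norm_neg, sub_neg_eq_add]
  have i1 := integrableOn_div_norm_rpow hN hs hs1 hε (f := fun z => φ x - φ (x - z))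
    (by fun_prop) (fun z => hbd _ _)
  have i2 := integrableOn_div_norm_rpow hN hs hs1 hε (f := fun z => φ x - φ (x + z))
    (by fun_prop) (fun z => hbd _ _)
  have h3 : ∫ z in S, secondDiff φ x z / ‖z‖ ^ a
      = truncFracLaplacian s ε φ x + truncFracLaplacian s ε φ x := by
    nth_rewrite 1 [h1]
    rw [h2, ← integral_add i1 i2]
    refine integral_congr_ae (Eventually.of_forall fun z => ?_)
    simp only [secondDiff, a]
    ring
  rw [h3]; ring

theorem abs_truncFracLaplacian_le (hN : 1 ≤ N) {s : ℝ} (hs : 1 / 2 < s) (hs1 : s < 1) {ε : ℝ}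
    (hε : 0 < ε) {φ : EuclideanSpace ℝ (Fin N) → ℝ} (hφ : Continuous φ) {M C : ℝ}
    (hM : ∀ z, |φ z| ≤ M) (hC : ∀ x z, |secondDiff φ x z| ≤ C * (‖z‖ * min 1 ‖z‖))
    (x : EuclideanSpace ℝ (Fin N)) :
    |truncFracLaplacian s ε φ x| ≤ (1 / 2) * ∫ z, C * levyKernel (N := N) s z := by
  have hint := (integrable_levyKernel (N := N) hN hs hs1).const_mul C
  rw [truncFracLaplacian_eq hN hs hs1 hε hφ hM, abs_mul, abs_of_pos (by norm_num : (0:ℝ) < 1 / 2)]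
  gcongr
  rw [← Real.norm_eq_abs, ← integral_indicator (measurableSet_le_norm ε)]
  refine norm_integral_le_of_norm_le hint (Eventually.of_forall fun z => ?_)
  exact (norm_indicator_le_norm_self _ _).trans (abs_secondDiff_div_le hC s x z)

theorem abs_symFracLaplacian_le (hN : 1 ≤ N) {s : ℝ} (hs : 1 / 2 < s) (hs1 : s < 1)
    {φ : EuclideanSpace ℝ (Fin N) → ℝ} {C : ℝ}
    (hC : ∀ x z, |secondDiff φ x z| ≤ C * (‖z‖ * min 1 ‖z‖))
    (x : EuclideanSpace ℝ (Fin N)) :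
    |symFracLaplacian s φ x| ≤ (1 / 2) * ∫ z, C * levyKernel (N := N) s z := by
  have hint := (integrable_levyKernel (N := N) hN hs hs1).const_mul C
  rw [symFracLaplacian, abs_mul, abs_of_pos (by norm_num : (0:ℝ) < 1 / 2)]
  gcongr
  exact norm_integral_le_of_norm_le hint (Eventually.of_forall (abs_secondDiff_div_le hC s x))

/-- The symmetric integrand is absolutely integrable, so dominated convergence removes the
truncation: its indicator is eventually 1 at each `z ≠ 0`. -/
theorem tendsto_truncFracLaplacian (hN : 1 ≤ N) {s : ℝ} (hs : 1 / 2 < s) (hs1 : s < 1)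
    {φ : EuclideanSpace ℝ (Fin N) → ℝ} (hφ : Continuous φ) {M C : ℝ}
    (hM : ∀ z, |φ z| ≤ M) (hC : ∀ x z, |secondDiff φ x z| ≤ C * (‖z‖ * min 1 ‖z‖))
    (x : EuclideanSpace ℝ (Fin N)) :
    Tendsto (fun ε => truncFracLaplacian s ε φ x) (𝓝[>] 0) (𝓝 (symFracLaplacian s φ x)) := by
  set F : EuclideanSpace ℝ (Fin N) → ℝ := fun z => secondDiff φ x z / ‖z‖ ^ ((N : ℝ) + 2 * s)
  have hF : Integrable F := integrable_secondDiff_div hN hs hs1 hφ hC x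
  have hev : ∀ᶠ ε : ℝ in 𝓝[>] 0, (1 / 2) * ∫ z, {z | ε ≤ ‖z‖}.indicator F z
      = truncFracLaplacian s ε φ x := by
    filter_upwards [self_mem_nhdsWithin] with ε hε
    rw [truncFracLaplacian_eq hN hs hs1 hε hφ hM, integral_indicator (measurableSet_le_norm ε)]
  refine Tendsto.congr' hev ?_
  refine Tendsto.const_mul _ ?_
  refine tendsto_integral_filter_of_dominated_convergence (fun z => ‖F z‖)
    (Eventually.of_forall fun ε => hF.1.indicator (measurableSet_le_norm ε))
    (Eventually.of_forall fun ε => Eventually.of_forall fun z => norm_indicator_le_norm_self _ _)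
    hF.norm ?_
  have h0 : ∀ᵐ z : EuclideanSpace ℝ (Fin N), z ≠ 0 := by
    have : Nonempty (Fin N) := ⟨⟨0, hN⟩⟩
    exact Measure.ae_ne volume 0
  filter_upwards [h0] with z hz
  refine tendsto_const_nhds.congr' ?_
  filter_upwards [Ioo_mem_nhdsGT (norm_pos_iff.2 hz)] with ε hε
  exact (indicator_of_mem (show z ∈ {z | ε ≤ ‖z‖} from hε.2.le) F).symm

theorem IsTestFunction.fracLaplacian_eq (hN : 1 ≤ N) {s : ℝ} (hs : 1 / 2 < s) (hs1 : s < 1)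
    {Ω : Set (EuclideanSpace ℝ (Fin N))} {φ : EuclideanSpace ℝ (Fin N) → ℝ}
    (h : IsTestFunction Ω φ) : fracLaplacian s φ = symFracLaplacian s φ := by
  obtain ⟨M, -, hM⟩ := h.exists_bound
  obtain ⟨C, -, hC⟩ := h.exists_abs_secondDiff_le
  exact funext fun x => (tendsto_truncFracLaplacian hN hs hs1 h.continuous hM hC x).limUnder_eq

/-- Smooth functions with compact support in a bounded open set belong to the test space. -/
theorem IsTestFunction.memTestSpace (hN : 1 ≤ N) {s : ℝ} (hs : 1 / 2 < s) (hs1 : s < 1)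
    {Ω : Set (EuclideanSpace ℝ (Fin N))} (hΩb : Bornology.IsBounded Ω)
    {φ : EuclideanSpace ℝ (Fin N) → ℝ} (h : IsTestFunction Ω φ) : MemTestSpace s Ω φ := by
  obtain ⟨M, -, hM⟩ := h.exists_bound
  obtain ⟨C, hC0, hC⟩ := h.exists_abs_secondDiff_le
  set B : ℝ := (1 / 2) * ∫ z, C * levyKernel (N := N) s z
  have hB : 0 ≤ B := (abs_nonneg _).trans (abs_symFracLaplacian_le hN hs hs1 hC 0)
  -- `B` bounds all truncations uniformly, so it is a constant dominating function and `ε₀ = 1` is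
  -- arbitrary; `B + 1` only ensures strict positivity.
  refine ⟨h.continuous, h.tsupport_subset.trans subset_closure, fun x _ => ?_,
    ⟨B + 1, by linarith, fun x _ => ?_⟩, ⟨fun _ => B, ?_, 1, one_pos, fun ε hε _ => ?_⟩⟩
  · rw [h.fracLaplacian_eq hN hs hs1]
    exact tendsto_truncFracLaplacian hN hs hs1 h.continuous hM hC x
  · rw [h.fracLaplacian_eq hN hs hs1]
    exact (abs_symFracLaplacian_le hN hs hs1 hC x).trans (le_add_of_nonneg_right zero_le_one)
  · have hc : Continuous fun x => B * Metric.infDist x Ωᶜ ^ s :=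
      continuous_const.mul ((Metric.continuous_infDist_pt _).rpow_const
        fun _ => Or.inr (by linarith))
    exact (hc.continuousOn.integrableOn_compact hΩb.isCompact_closure).mono_set subset_closure
  · exact Eventually.of_forall fun x =>
      abs_truncFracLaplacian_le hN hs hs1 hε h.continuous hM hC x

/-! ### Hölder estimates and the bilinear form -/

theorem enorm_integral_mul_le_eLpNorm {α : Type*} [MeasurableSpace α] {μ : Measure α} {p q : ℝ}
    (hpq : p.HolderConjugate q) {f g : α → ℝ} (hf : AEStronglyMeasurable f μ)
    (hg : AEStronglyMeasurable g μ) :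
    ‖∫ x, f x * g x ∂μ‖ₑ ≤ eLpNorm f (ENNReal.ofReal p) μ * eLpNorm g (ENNReal.ofReal q) μ := by
  have := hpq.ennrealOfReal
  refine (enorm_integral_le_lintegral_enorm _).trans ?_
  have h := eLpNorm_smul_le_mul_eLpNorm (p := ENNReal.ofReal p) (q := ENNReal.ofReal q) (r := 1)
    hg hf
  rwa [eLpNorm_one_eq_lintegral_enorm] at h

theorem abs_integral_mul_le_of_eLpNorm_le {α : Type*} [MeasurableSpace α] {μ : Measure α} {p q : ℝ}
    (hpq : p.HolderConjugate q) {f g : α → ℝ} (hf : AEStronglyMeasurable f μ)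
    (hg : AEStronglyMeasurable g μ) {A B : ℝ} (hA : 0 ≤ A) (hB : 0 ≤ B)
    (hfA : eLpNorm f (ENNReal.ofReal p) μ ≤ ENNReal.ofReal A)
    (hgB : eLpNorm g (ENNReal.ofReal q) μ ≤ ENNReal.ofReal B) :
    |∫ x, f x * g x ∂μ| ≤ A * B := by
  have h := (enorm_integral_mul_le_eLpNorm hpq hf hg).trans (mul_le_mul' hfA hgB)
  rw [← ENNReal.ofReal_mul hA, ← ofReal_norm,
    ENNReal.ofReal_le_ofReal_iff (by positivity)] at h
  exact h

theorem norm_gradient (ψ : EuclideanSpace ℝ (Fin N) → ℝ) (x : EuclideanSpace ℝ (Fin N)) :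
    ‖gradient ψ x‖ = ‖fderiv ℝ ψ x‖ := by
  unfold gradient; exact LinearIsometryEquiv.norm_map _ _

/-- Hölder's inequality for the increments of a smooth function, tested against a function with
compact support. -/
theorem IsTestFunction.abs_integral_increment_mul_le {p q : ℝ} (hpq : p.HolderConjugate q)
    {Ω : Set (EuclideanSpace ℝ (Fin N))} {ψ h : EuclideanSpace ℝ (Fin N) → ℝ}
    (hψ : IsTestFunction Ω ψ) (hh : Continuous h) (hhc : HasCompactSupport h) {A B : ℝ}
    (hA : 0 ≤ A) (hB : 0 ≤ B)
    (hψA : eLpNorm (gradient ψ) (ENNReal.ofReal p) volume ≤ ENNReal.ofReal A)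
    (hhB : eLpNorm h (ENNReal.ofReal q) volume ≤ ENNReal.ofReal B)
    (z : EuclideanSpace ℝ (Fin N)) :
    |∫ x, (ψ (x + z) - ψ x) * h x| ≤ ‖z‖ * A * B := by
  have hdc : Continuous (fderiv ℝ ψ) := hψ.contDiff.continuous_fderiv (by simp)
  obtain ⟨K, hK⟩ := hdc.bounded_above_of_compact_support (hψ.hasCompactSupport.fderiv ℝ)
  have hi : ∀ t : ℝ, Integrable fun x => ψ (x + t • z) * h x := fun t =>
    (((hψ.continuous.comp (continuous_id.add continuous_const)).mul
      hh)).integrable_of_hasCompactSupport hhc.mul_left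
  -- Differentiating the pairing in `t` and applying Hölder to the derivative replaces Minkowski's
  -- integral inequality; translation invariance makes the bound uniform in `t`.
  have hder : ∀ t : ℝ, HasDerivAt (fun t : ℝ => ∫ x, ψ (x + t • z) * h x)
      (∫ x, fderiv ℝ ψ (x + t • z) z * h x) t := by
    intro t
    refine (hasDerivAt_integral_of_dominated_loc_of_deriv_le (s := univ)
      (F' := fun t x => fderiv ℝ ψ (x + t • z) z * h x)
      (bound := fun x => K * ‖z‖ * ‖h x‖) univ_mem (Eventually.of_forall fun t => (hi t).1) (hi t)
      (Continuous.aestronglyMeasurable (by fun_prop)) (Eventually.of_forall fun x τ _ => ?_)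
      ((hh.integrable_of_hasCompactSupport hhc).norm.const_mul _)
      (Eventually.of_forall fun x τ _ => ?_)).2
    · rw [norm_mul]
      gcongr
      exact (ContinuousLinearMap.le_opNorm _ _).trans (by gcongr; exact hK _)
    · have h0 : HasDerivAt (fun t : ℝ => x + t • z) z τ := by
        simpa using ((hasDerivAt_id τ).smul_const z).const_add x
      exact (((hψ.contDiff.differentiable (by simp)) _).hasFDerivAt.comp_hasDerivAt τ
        h0).mul_const _
  have hbound : ∀ t : ℝ, ‖∫ x, fderiv ℝ ψ (x + t • z) z * h x‖ ≤ ‖z‖ * A * B := by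
    intro t
    refine abs_integral_mul_le_of_eLpNorm_le hpq
      (Continuous.aestronglyMeasurable (by fun_prop)) hh.aestronglyMeasurable (by positivity) hB
      ?_ hhB
    have hgm : AEStronglyMeasurable (gradient ψ) volume := by
      have : Continuous (gradient ψ) := by
        unfold gradient
        exact (LinearIsometryEquiv.continuous _).comp hdc
      exact this.aestronglyMeasurable
    have e := eLpNorm_comp_measurePreserving (p := ENNReal.ofReal p) hgm
      (measurePreserving_add_right volume (t • z))
    have := eLpNorm_le_mul_eLpNorm_of_ae_le_mul (c := ‖z‖) (p := ENNReal.ofReal p)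
      (μ := (volume : Measure (EuclideanSpace ℝ (Fin N))))
      (f := fun x => fderiv ℝ ψ (x + t • z) z) (g := gradient ψ ∘ fun x => x + t • z)
      (Eventually.of_forall fun x => by
        rw [Function.comp_apply, norm_gradient, mul_comm]
        exact ContinuousLinearMap.le_opNorm _ _)
    rw [e] at this
    rw [ENNReal.ofReal_mul (norm_nonneg z)]
    exact this.trans (by gcongr)
  have hm := norm_image_sub_le_of_norm_deriv_le_segment_01' (C := ‖z‖ * A * B)
    (fun t _ => (hder t).hasDerivWithinAt) (fun t _ => hbound t)
  have h1 := hi 1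
  have h0 := hi 0
  simp only [one_smul, zero_smul, add_zero] at hm h1 h0
  rw [← integral_sub h1 h0, Real.norm_eq_abs] at hm
  simpa only [sub_mul] using hm

/-- Discrete integration by parts: split the second difference into two first differences and
translate by `z` only the one involving `φ(x - z)`. -/
theorem integral_mul_secondDiff {ψ φ : EuclideanSpace ℝ (Fin N) → ℝ} (hψ : Continuous ψ)
    (hψc : HasCompactSupport ψ) (hφ : Continuous φ) (z : EuclideanSpace ℝ (Fin N)) :
    ∫ x, ψ x * secondDiff φ x z = ∫ x, (ψ (x + z) - ψ x) * (φ (x + z) - φ x) := by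
  have i1 : Integrable fun x => ψ x * (φ x - φ (x - z)) :=
    (hψ.mul (by fun_prop)).integrable_of_hasCompactSupport hψc.mul_right
  have i2 : Integrable fun x => ψ x * (φ x - φ (x + z)) :=
    (hψ.mul (by fun_prop)).integrable_of_hasCompactSupport hψc.mul_right
  have i3 : Integrable fun x => ψ (x + z) * (φ (x + z) - φ x) := by
    simpa using i1.comp_add_right z
  have e : ∫ x, ψ x * (φ x - φ (x - z)) = ∫ x, ψ (x + z) * (φ (x + z) - φ x) := by
    rw [← integral_add_right_eq_self _ z]
    simp
  calc ∫ x, ψ x * secondDiff φ x z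
      = ∫ x, (ψ x * (φ x - φ (x - z)) + ψ x * (φ x - φ (x + z))) := by
        congr 1; ext x; unfold secondDiff; ring
    _ = ∫ x, (ψ (x + z) * (φ (x + z) - φ x) + ψ x * (φ x - φ (x + z))) := by
        rw [integral_add i1 i2, e, ← integral_add i3 i2]
    _ = _ := by congr 1; ext x; ring

/-- Fubini, with majorant `|ψ(x)|` times `C * levyKernel s z` on the product. -/
theorem integral_mul_symFracLaplacian (hN : 1 ≤ N) {s : ℝ} (hs : 1 / 2 < s) (hs1 : s < 1)
    {ψ φ : EuclideanSpace ℝ (Fin N) → ℝ} (hψ : Continuous ψ) (hψc : HasCompactSupport ψ)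
    (hφ : Continuous φ) {C : ℝ} (hC : ∀ x z, |secondDiff φ x z| ≤ C * (‖z‖ * min 1 ‖z‖)) :
    ∫ x, ψ x * symFracLaplacian s φ x
      = (1 / 2) * ∫ z, (∫ x, ψ x * secondDiff φ x z) / ‖z‖ ^ ((N : ℝ) + 2 * s) := by
  set a : ℝ := (N : ℝ) + 2 * s
  have hint : Integrable (Function.uncurry fun x z : EuclideanSpace ℝ (Fin N) =>
      ψ x * (secondDiff φ x z / ‖z‖ ^ a)) (volume.prod volume) := by
    refine ((hψ.integrable_of_hasCompactSupport hψc).norm.mul_prod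
      ((integrable_levyKernel hN hs hs1).const_mul C)).mono' ?_ (Eventually.of_forall fun w => ?_)
    · have h1 : Measurable fun w : EuclideanSpace ℝ (Fin N) × EuclideanSpace ℝ (Fin N) =>
          ψ w.1 * secondDiff φ w.1 w.2 := by
        have : Continuous fun w : EuclideanSpace ℝ (Fin N) × EuclideanSpace ℝ (Fin N) =>
          ψ w.1 * secondDiff φ w.1 w.2 := by unfold secondDiff; fun_prop
        exact this.measurable
      have h2 := h1.div ((measurable_norm_rpow (N := N) a).comp measurable_snd)
      refine h2.aestronglyMeasurable.congr (Eventually.of_forall fun w => ?_)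
      simp only [Function.uncurry, Pi.div_apply, Function.comp_apply, mul_div_assoc]
    · simp only [Function.uncurry, norm_mul]
      gcongr
      exact abs_secondDiff_div_le hC s w.1 w.2
  calc ∫ x, ψ x * symFracLaplacian s φ x
      = ∫ x, (1 / 2) * ∫ z, ψ x * (secondDiff φ x z / ‖z‖ ^ a) := by
        congr 1; ext x
        rw [integral_const_mul, symFracLaplacian]
        ring
    _ = (1 / 2) * ∫ z, ∫ x, ψ x * (secondDiff φ x z / ‖z‖ ^ a) := by
        rw [integral_const_mul, integral_integral_swap hint]
    _ = _ := by
        congr 2; ext z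
        simp only [← mul_div_assoc]
        rw [integral_div]

/-! ### Scaling of the kernel and the dual estimate -/

theorem levyKernel_inv_smul (s : ℝ) {r : ℝ} (hr : 0 < r) (z : EuclideanSpace ℝ (Fin N)) :
    ‖z‖ * min 1 (‖z‖ / r) / ‖z‖ ^ ((N : ℝ) + 2 * s)
      = r ^ (1 - ((N : ℝ) + 2 * s)) * levyKernel s (r⁻¹ • z) := by
  rw [levyKernel, norm_smul, norm_inv, Real.norm_of_nonneg hr.le,
    Real.mul_rpow (by positivity) (norm_nonneg z), Real.inv_rpow hr.le, sub_eq_add_neg,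
    Real.rpow_add hr, Real.rpow_neg hr.le, Real.rpow_one, inv_mul_eq_div]
  have : 0 < r ^ ((N : ℝ) + 2 * s) := Real.rpow_pos_of_pos hr _
  rcases eq_or_ne z 0 with rfl | hz
  · simp
  have : 0 < ‖z‖ := norm_pos_iff.2 hz
  have : 0 < ‖z‖ ^ ((N : ℝ) + 2 * s) := Real.rpow_pos_of_pos this _
  field_simp

/-- The Jacobian `r^N` cancels the `-N` in the exponent. -/
theorem integral_rescaled_levyKernel (s : ℝ) {r : ℝ} (hr : 0 < r) :
    ∫ z : EuclideanSpace ℝ (Fin N), r ^ (1 - ((N : ℝ) + 2 * s)) * levyKernel s (r⁻¹ • z)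
      = r ^ (1 - 2 * s) * ∫ z, levyKernel (N := N) s z := by
  rw [integral_const_mul, Measure.integral_comp_inv_smul, finrank_euclideanSpace_fin,
    abs_of_pos (by positivity), smul_eq_mul, ← mul_assoc, ← Real.rpow_natCast,
    ← Real.rpow_add hr]
  congr 2
  ring

/-- If the increments of `φ` are of size `D min(1, |z| / r)` in `L^q`, then the pairing of its
fractional Laplacian with a smooth `ψ` is controlled by the norm of `∇ψ` in the dual space. -/
theorem IsTestFunction.abs_integral_mul_symFracLaplacian_le (hN : 1 ≤ N) {s : ℝ} (hs : 1 / 2 < s)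
    (hs1 : s < 1) {p q : ℝ} (hpq : p.HolderConjugate q) {Ω Ω' : Set (EuclideanSpace ℝ (Fin N))}
    {ψ φ : EuclideanSpace ℝ (Fin N) → ℝ} (hψ : IsTestFunction Ω ψ) (hφ : IsTestFunction Ω' φ)
    {A D r : ℝ} (hA : 0 ≤ A) (hD : 0 ≤ D) (hr : 0 < r)
    (hψA : eLpNorm (gradient ψ) (ENNReal.ofReal p) volume ≤ ENNReal.ofReal A)
    (hφD : ∀ z, eLpNorm (fun x => φ (x + z) - φ x) (ENNReal.ofReal q) volume
      ≤ ENNReal.ofReal (D * min 1 (‖z‖ / r))) :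
    |∫ x, ψ x * symFracLaplacian s φ x|
      ≤ A * D * (r ^ (1 - 2 * s) * ∫ z, levyKernel (N := N) s z) := by
  obtain ⟨C, -, hC⟩ := hφ.exists_abs_secondDiff_le
  rw [integral_mul_symFracLaplacian hN hs hs1 hψ.continuous hψ.hasCompactSupport hφ.continuous hC,
    abs_mul, abs_of_pos (by norm_num : (0:ℝ) < 1 / 2), ← integral_rescaled_levyKernel s hr,
    ← integral_const_mul]
  have hint : Integrable fun z : EuclideanSpace ℝ (Fin N) =>
      A * D * (r ^ (1 - ((N : ℝ) + 2 * s)) * levyKernel s (r⁻¹ • z)) :=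
    (((integrable_levyKernel hN hs hs1).comp_smul (inv_ne_zero hr.ne')).const_mul _).const_mul _
  have hle := norm_integral_le_of_norm_le hint
    (f := fun z => (∫ x, ψ x * secondDiff φ x z) / ‖z‖ ^ ((N : ℝ) + 2 * s))
    (Eventually.of_forall fun z => by
      rw [← levyKernel_inv_smul s hr, integral_mul_secondDiff hψ.continuous hψ.hasCompactSupport
        hφ.continuous, norm_div, Real.norm_of_nonneg (by positivity : 0 ≤ ‖z‖ ^ ((N : ℝ) + 2 * s)),
        ← mul_div_assoc]
      refine div_le_div_of_nonneg_right ?_ (by positivity)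
      have hc : HasCompactSupport fun x => φ (x + z) - φ x :=
        (hφ.hasCompactSupport.comp_homeomorph (Homeomorph.addRight z)).sub hφ.hasCompactSupport
      -- The factor `|z|` comes from `ψ` and `min(1, |z|/r)` from `φ`; together they form the
      -- numerator of the rescaled kernel.
      refine (hψ.abs_integral_increment_mul_le hpq ((hφ.continuous.comp
        (continuous_id.add continuous_const)).sub hφ.continuous) hc hA (by positivity) hψA
        (hφD z) z).trans (le_of_eq ?_)
      ring)
  rw [Real.norm_eq_abs] at hle
  -- Nonnegativity allows the factor `1/2` to be dropped.
  have h0 := abs_nonneg (∫ z, (∫ x, ψ x * secondDiff φ x z) / ‖z‖ ^ ((N : ℝ) + 2 * s))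
  linarith

/-! ### Cutoffs concentrating at a point -/

/-- The rescaling `x ↦ η ((x - x₀) / r)` of `η`. -/
def rescale (η : EuclideanSpace ℝ (Fin N) → ℝ) (x₀ : EuclideanSpace ℝ (Fin N)) (r : ℝ)
    (x : EuclideanSpace ℝ (Fin N)) : ℝ := η (r⁻¹ • (x - x₀))

theorem exists_cutoff (N : ℕ) : ∃ η : EuclideanSpace ℝ (Fin N) → ℝ, ContDiff ℝ ∞ η ∧ η 0 = 1 ∧
    (∀ x, 0 ≤ η x) ∧ (∀ x, η x ≤ 1) ∧ ∀ x, 1 ≤ ‖x‖ → η x = 0 := by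
  let b : ContDiffBump (0 : EuclideanSpace ℝ (Fin N)) := ⟨1 / 2, 1, by norm_num, by norm_num⟩
  refine ⟨b, b.contDiff, b.one_of_mem_closedBall (by simp [b.rIn_pos.le]), fun x => b.nonneg,
    fun x => b.le_one, fun x hx => b.zero_of_le_dist ?_⟩
  rw [dist_zero_right]
  exact hx

theorem rescale_eq_zero {η : EuclideanSpace ℝ (Fin N) → ℝ} (hη : ∀ x, 1 ≤ ‖x‖ → η x = 0)
    {x₀ x : EuclideanSpace ℝ (Fin N)} {r : ℝ} (hr : 0 < r) (hx : x ∉ Metric.ball x₀ r) :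
    rescale η x₀ r x = 0 := by
  apply hη
  rw [Metric.mem_ball, not_lt, dist_eq_norm] at hx
  rw [norm_smul, norm_inv, Real.norm_of_nonneg hr.le, inv_mul_eq_div]
  exact (one_le_div hr).2 hx

theorem isTestFunction_rescale {η : EuclideanSpace ℝ (Fin N) → ℝ} (hηs : ContDiff ℝ ∞ η)
    (hη : ∀ x, 1 ≤ ‖x‖ → η x = 0) {Ω : Set (EuclideanSpace ℝ (Fin N))}
    {x₀ : EuclideanSpace ℝ (Fin N)} {r : ℝ} (hr : 0 < r) (hΩ : Metric.closedBall x₀ r ⊆ Ω) :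
    IsTestFunction Ω (rescale η x₀ r) := by
  have hts : tsupport (rescale η x₀ r) ⊆ Metric.closedBall x₀ r := by
    refine closure_minimal (fun x hx => ?_) Metric.isClosed_closedBall
    by_contra h
    exact hx (rescale_eq_zero hη hr fun h' => h (Metric.ball_subset_closedBall h'))
  refine ⟨hηs.comp (by fun_prop), ?_, hts.trans hΩ⟩
  exact (isCompact_closedBall x₀ r).of_isClosed_subset (isClosed_tsupport _) hts

/-- The increment is pointwise at most a multiple of `min(1, |z|/r)` and lives on two balls of
radius `r`; the `q`-th root of their volume produces `r^(N/q)`, uniformly in `z`. -/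
theorem exists_eLpNorm_increment_rescale_le (hN : 1 ≤ N) {q : ℝ} (hq : 0 < q)
    {η : EuclideanSpace ℝ (Fin N) → ℝ} (hηs : ContDiff ℝ ∞ η) (h0 : ∀ x, 0 ≤ η x)
    (h1 : ∀ x, η x ≤ 1) (hη : ∀ x, 1 ≤ ‖x‖ → η x = 0) (x₀ : EuclideanSpace ℝ (Fin N)) :
    ∃ D : ℝ, 0 ≤ D ∧ ∀ r : ℝ, 0 < r → ∀ z,
      eLpNorm (fun x => rescale η x₀ r (x + z) - rescale η x₀ r x) (ENNReal.ofReal q) volume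
        ≤ ENNReal.ofReal (D * r ^ ((N : ℝ) / q) * min 1 (‖z‖ / r)) := by
  have : Nonempty (Fin N) := ⟨⟨0, hN⟩⟩
  have hηc : HasCompactSupport η :=
    HasCompactSupport.of_support_subset_isCompact (isCompact_closedBall 0 1) fun x hx => by
      by_contra h
      rw [mem_closedBall_zero_iff, not_le] at h
      exact hx (hη x h.le)
  obtain ⟨K, hK⟩ := hηs.lipschitzWith_of_hasCompactSupport (𝕂 := ℝ) hηc (by simp)
  -- `1` covers the oscillation of a function with values in `[0, 1]`, and `K` the Lipschitz bound.
  set L : ℝ := max 1 K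
  have hL : 0 ≤ L := zero_le_one.trans (le_max_left _ _)
  set V : ℝ := (volume (Metric.ball (0 : EuclideanSpace ℝ (Fin N)) 1)).toReal
  have hV : 0 ≤ V := ENNReal.toReal_nonneg
  refine ⟨L * (2 * V) ^ (1 / q), by positivity, fun r hr z => ?_⟩
  have hinc : ∀ x, |rescale η x₀ r (x + z) - rescale η x₀ r x| ≤ L * min 1 (‖z‖ / r) := by
    intro x
    rw [mul_min_of_nonneg _ _ hL, mul_one]
    refine le_min ((abs_le.2 ⟨?_, ?_⟩).trans (le_max_left _ _)) ?_
    · linarith [h0 (r⁻¹ • (x + z - x₀)), h1 (r⁻¹ • (x - x₀)), show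
        rescale η x₀ r (x + z) - rescale η x₀ r x
          = η (r⁻¹ • (x + z - x₀)) - η (r⁻¹ • (x - x₀)) from rfl]
    · linarith [h1 (r⁻¹ • (x + z - x₀)), h0 (r⁻¹ • (x - x₀)), show
        rescale η x₀ r (x + z) - rescale η x₀ r x
          = η (r⁻¹ • (x + z - x₀)) - η (r⁻¹ • (x - x₀)) from rfl]
    · have h := hK.norm_sub_le (r⁻¹ • (x + z - x₀)) (r⁻¹ • (x - x₀))
      rw [← smul_sub, show x + z - x₀ - (x - x₀) = z by abel, norm_smul, norm_inv,
        Real.norm_of_nonneg hr.le, inv_mul_eq_div] at h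
      exact h.trans (by gcongr; exact le_max_right _ _)
  set S : Set (EuclideanSpace ℝ (Fin N)) := Metric.ball (x₀ - z) r ∪ Metric.ball x₀ r
  have hS : volume S ≤ ENNReal.ofReal (2 * V * r ^ N) := by
    refine (measure_union_le _ _).trans (le_of_eq ?_)
    rw [Measure.addHaar_ball _ _ hr.le, Measure.addHaar_ball _ _ hr.le, finrank_euclideanSpace_fin,
      ← ENNReal.ofReal_toReal (measure_ball_lt_top (x := (0 : EuclideanSpace ℝ (Fin N)))).ne,
      ← ENNReal.ofReal_mul (by positivity), ← ENNReal.ofReal_add (by positivity) (by positivity)]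
    congr 1
    ring
  have hle := eLpNorm_mono_real (p := ENNReal.ofReal q)
    (μ := (volume : Measure (EuclideanSpace ℝ (Fin N))))
    (f := fun x => rescale η x₀ r (x + z) - rescale η x₀ r x)
    (g := S.indicator fun _ => L * min 1 (‖z‖ / r)) (fun x => by
      by_cases hx : x ∈ S
      · rw [indicator_of_mem hx]
        exact hinc x
      · rw [indicator_of_notMem hx]
        have hx1 : x + z ∉ Metric.ball x₀ r := fun h => hx <| Or.inl <| by
          rw [Metric.mem_ball, dist_eq_norm] at h ⊢
          rwa [show x - (x₀ - z) = x + z - x₀ by abel]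
        have hx2 : x ∉ Metric.ball x₀ r := fun h => hx (Or.inr h)
        rw [rescale_eq_zero hη hr hx1, rescale_eq_zero hη hr hx2]
        simp)
  refine hle.trans ((eLpNorm_indicator_const_le _ _).trans ?_)
  have hm : 0 ≤ L * min 1 (‖z‖ / r) := by positivity
  rw [ENNReal.toReal_ofReal hq.le, ← ofReal_norm, Real.norm_of_nonneg hm]
  have hrp : (2 * V * r ^ N) ^ (1 / q) = (2 * V) ^ (1 / q) * r ^ ((N : ℝ) / q) := by
    rw [Real.mul_rpow (by positivity) (by positivity), ← Real.rpow_natCast, ← Real.rpow_mul hr.le,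
      mul_one_div]
  calc ENNReal.ofReal (L * min 1 (‖z‖ / r)) * volume S ^ (1 / q)
      ≤ ENNReal.ofReal (L * min 1 (‖z‖ / r)) * ENNReal.ofReal (2 * V * r ^ N) ^ (1 / q) := by
        gcongr
    _ = _ := by
        rw [ENNReal.ofReal_rpow_of_nonneg (by positivity) (by positivity),
          ← ENNReal.ofReal_mul hm, hrp]
        congr 1
        ring

/-! ### Passage from smooth functions to the Sobolev space -/

theorem measurable_symFracLaplacian (s : ℝ) {φ : EuclideanSpace ℝ (Fin N) → ℝ}
    (hφ : Continuous φ) : Measurable (symFracLaplacian s φ) := by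
  have h1 : Measurable fun w : EuclideanSpace ℝ (Fin N) × EuclideanSpace ℝ (Fin N) =>
      secondDiff φ w.1 w.2 := by
    have : Continuous fun w : EuclideanSpace ℝ (Fin N) × EuclideanSpace ℝ (Fin N) =>
      secondDiff φ w.1 w.2 := by unfold secondDiff; fun_prop
    exact this.measurable
  have h2 := h1.div ((measurable_norm_rpow (N := N) ((N : ℝ) + 2 * s)).comp measurable_snd)
  exact (h2.stronglyMeasurable.integral_prod_right' (ν := volume)).measurable.const_mul _

theorem IsTestFunction.support_gradient_subset {Ω : Set (EuclideanSpace ℝ (Fin N))}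
    {ψ : EuclideanSpace ℝ (Fin N) → ℝ} (hψ : IsTestFunction Ω ψ) :
    Function.support (gradient ψ) ⊆ Ω := by
  intro x hx
  refine hψ.tsupport_subset (tsupport_fderiv_subset ℝ (subset_tsupport _ ?_))
  rwa [Function.mem_support, ← norm_ne_zero_iff, ← norm_gradient, norm_ne_zero_iff]

theorem IsTestFunction.eq_zero_of_notMem {Ω : Set (EuclideanSpace ℝ (Fin N))}
    {ψ : EuclideanSpace ℝ (Fin N) → ℝ} (hψ : IsTestFunction Ω ψ) {x : EuclideanSpace ℝ (Fin N)}
    (hx : x ∉ Ω) : ψ x = 0 :=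
  image_eq_zero_of_notMem_tsupport fun h => hx (hψ.tsupport_subset h)

theorem IsTestFunction.continuous_gradient {Ω : Set (EuclideanSpace ℝ (Fin N))}
    {ψ : EuclideanSpace ℝ (Fin N) → ℝ} (hψ : IsTestFunction Ω ψ) : Continuous (gradient ψ) := by
  unfold gradient
  exact (LinearIsometryEquiv.continuous _).comp (hψ.contDiff.continuous_fderiv (by simp))

/-- Convergence in `L^p` on a set of finite measure passes to the integral against a bounded
function. -/
theorem tendsto_integral_mul_of_tendsto_eLpNorm {α : Type*} [MeasurableSpace α] {μ : Measure α}
    [IsFiniteMeasure μ] {p q : ℝ} (hpq : p.HolderConjugate q) {f : ℕ → α → ℝ} {u g : α → ℝ}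
    (hf : ∀ n, Integrable (f n) μ) (hu : Integrable u μ) (hg : AEStronglyMeasurable g μ) {K : ℝ}
    (hK : ∀ x, |g x| ≤ K)
    (hlim : Tendsto (fun n => eLpNorm (fun x => f n x - u x) (ENNReal.ofReal p) μ) atTop (𝓝 0)) :
    Tendsto (fun n => ∫ x, f n x * g x ∂μ) atTop (𝓝 (∫ x, u x * g x ∂μ)) := by
  have hgq : eLpNorm g (ENNReal.ofReal q) μ ≠ ⊤ :=
    (MemLp.of_bound hg K (Eventually.of_forall hK)).2.ne
  have hi : ∀ {v : α → ℝ}, Integrable v μ → Integrable (fun x => v x * g x) μ := fun hv =>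
    hv.mul_bdd hg (Eventually.of_forall hK)
  rw [tendsto_iff_edist_tendsto_0]
  have hz := ENNReal.Tendsto.mul_const hlim (Or.inr hgq)
  rw [zero_mul] at hz
  refine tendsto_of_tendsto_of_tendsto_of_le_of_le tendsto_const_nhds hz
    (fun _ => zero_le) fun n => ?_
  simp only []
  rw [edist_eq_enorm_sub, ← integral_sub (hi (hf n)) (hi hu)]
  simp only [← sub_mul]
  exact enorm_integral_mul_le_eLpNorm hpq ((hf n).1.sub hu.1) hg

/-- The pairing of the fractional Laplacian of the cutoff at scale `r` with a function in `W^{1,p}_0`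
is of order `r^(N / p' + 1 - 2 s)`. -/
theorem MemSobolevZero.exists_abs_integral_mul_fracLaplacian_le (hN : 1 ≤ N) {s : ℝ}
    (hs : 1 / 2 < s) (hs1 : s < 1) {p q : ℝ} (hpq : p.HolderConjugate q)
    {Ω : Set (EuclideanSpace ℝ (Fin N))} (hΩb : Bornology.IsBounded Ω)
    {u : EuclideanSpace ℝ (Fin N) → ℝ} (hu : MemSobolevZero Ω p u) (hui : IntegrableOn u Ω)
    {η : EuclideanSpace ℝ (Fin N) → ℝ} (hηs : ContDiff ℝ ∞ η) (h0 : ∀ x, 0 ≤ η x)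
    (h1 : ∀ x, η x ≤ 1) (hη : ∀ x, 1 ≤ ‖x‖ → η x = 0) (x₀ : EuclideanSpace ℝ (Fin N)) :
    ∃ B : ℝ, ∀ r : ℝ, 0 < r → Metric.closedBall x₀ r ⊆ Ω →
      |∫ x in Ω, u x * fracLaplacian s (rescale η x₀ r) x|
        ≤ B * r ^ ((N : ℝ) / q + (1 - 2 * s)) := by
  obtain ⟨G, -, -, hG, ψ, hψ, hψu, hψG⟩ := hu
  obtain ⟨D, hD, hinc⟩ := exists_eLpNorm_increment_rescale_le hN hpq.symm.pos hηs h0 h1 hη x₀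
  set μ : Measure (EuclideanSpace ℝ (Fin N)) := volume.restrict Ω
  have : IsFiniteMeasure μ := ⟨by
    rw [Measure.restrict_apply_univ]
    exact hΩb.measure_lt_top⟩
  -- Eventually `‖∇ψ_n - G‖_p < 1`, so `A` bounds `‖∇ψ_n‖_p`. It does not depend on `r`.
  set A : ℝ := (1 + eLpNorm G (ENNReal.ofReal p) μ).toReal
  have hAtop : 1 + eLpNorm G (ENNReal.ofReal p) μ ≠ ⊤ :=
    ENNReal.add_ne_top.2 ⟨ENNReal.one_ne_top, hG.2.ne⟩
  have hA : 0 ≤ A := ENNReal.toReal_nonneg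
  have hp1 : 1 ≤ ENNReal.ofReal p := by
    rw [← ENNReal.ofReal_one]
    exact ENNReal.ofReal_le_ofReal hpq.lt.le
  have hgrad : ∀ᶠ n in atTop,
      eLpNorm (gradient (ψ n)) (ENNReal.ofReal p) volume ≤ ENNReal.ofReal A := by
    filter_upwards [hψG.eventually (gt_mem_nhds one_pos)] with n hn
    rw [← eLpNorm_restrict_eq_of_support_subset (hψ n).support_gradient_subset,
      ENNReal.ofReal_toReal hAtop]
    have e : gradient (ψ n) = (fun x => gradient (ψ n) x - G x) + G := by
      ext x; simp
    rw [e]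
    refine (eLpNorm_add_le ((hψ n).continuous_gradient.aestronglyMeasurable.sub hG.1) hG.1
      hp1).trans ?_
    gcongr
    exact hn.le
  refine ⟨A * D * ∫ z, levyKernel (N := N) s z, fun r hr hrΩ => ?_⟩
  have hφ := isTestFunction_rescale hηs hη hr hrΩ
  obtain ⟨C, -, hC⟩ := hφ.exists_abs_secondDiff_le
  rw [hφ.fracLaplacian_eq hN hs hs1]
  -- For fixed `r` the fractional Laplacian of the cutoff is bounded, so `ψ_n → u` in `L^p(Ω)`
  -- suffices; the bound may depend on `r`.
  have hlim := tendsto_integral_mul_of_tendsto_eLpNorm hpq (μ := μ)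
    (fun n => ((hψ n).continuous.integrable_of_hasCompactSupport
      (hψ n).hasCompactSupport).integrableOn) hui
    (measurable_symFracLaplacian s hφ.continuous).aestronglyMeasurable
    (abs_symFracLaplacian_le hN hs hs1 hC) hψu
  refine le_of_tendsto hlim.abs ?_
  filter_upwards [hgrad] with n hn
  rw [setIntegral_eq_integral_of_forall_compl_eq_zero fun x hx => by
    rw [(hψ n).eq_zero_of_notMem hx, zero_mul]]
  refine ((hψ n).abs_integral_mul_symFracLaplacian_le hN hs hs1 hpq hφ hA (by positivity) hr hn
    (hinc r hr)).trans (le_of_eq ?_)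
  rw [Real.rpow_add hr]
  ring

/-! ### The gradient term, the exponent and the conclusion -/

/-- Since `g` is only locally integrable, the integral is first confined to a fixed closed ball in
`Ω`; there `|g|` dominates, and the cutoffs tend to 0 off `x₀`, a null set. -/
theorem tendsto_integral_rescale_mul (hN : 1 ≤ N) {Ω : Set (EuclideanSpace ℝ (Fin N))}
    (hΩ : IsOpen Ω) {x₀ : EuclideanSpace ℝ (Fin N)} (hx₀ : x₀ ∈ Ω)
    {η : EuclideanSpace ℝ (Fin N) → ℝ} (hηs : Continuous η) (h0 : ∀ x, 0 ≤ η x)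
    (h1 : ∀ x, η x ≤ 1) (hη : ∀ x, 1 ≤ ‖x‖ → η x = 0) {g : EuclideanSpace ℝ (Fin N) → ℝ}
    (hg : LocallyIntegrableOn g Ω) :
    Tendsto (fun r => ∫ x in Ω, rescale η x₀ r x * g x) (𝓝[>] 0) (𝓝 0) := by
  obtain ⟨R, hR, hRΩ⟩ := Metric.nhds_basis_closedBall.mem_iff.1 (hΩ.mem_nhds hx₀)
  set B := Metric.closedBall x₀ R
  have hgB : IntegrableOn g B := hg.integrableOn_compact_subset hRΩ (isCompact_closedBall _ _)
  have hev : ∀ᶠ r : ℝ in 𝓝[>] 0, ∫ x in B, rescale η x₀ r x * g x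
      = ∫ x in Ω, rescale η x₀ r x * g x := by
    filter_upwards [Ioo_mem_nhdsGT hR] with r hr
    refine (setIntegral_eq_of_subset_of_forall_sdiff_eq_zero hΩ.measurableSet hRΩ
      fun x hx => ?_).symm
    rw [rescale_eq_zero hη hr.1 fun h => hx.2
      (Metric.ball_subset_closedBall (Metric.ball_subset_ball hr.2.le h)), zero_mul]
  refine Tendsto.congr' hev ?_
  have key : Tendsto (fun r => ∫ x in B, rescale η x₀ r x * g x) (𝓝[>] 0)
      (𝓝 (∫ _ in B, (0 : ℝ))) := by
    refine tendsto_integral_filter_of_dominated_convergence (fun x => ‖g x‖)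
      (Eventually.of_forall fun r => ?_) (Eventually.of_forall fun r =>
        Eventually.of_forall fun x => ?_) hgB.norm ?_
    · have hc : Continuous (rescale η x₀ r) := by unfold rescale; fun_prop
      exact hc.aestronglyMeasurable.mul hgB.1
    · rw [norm_mul]
      refine mul_le_of_le_one_left (norm_nonneg _) ?_
      rw [Real.norm_eq_abs, rescale, abs_of_nonneg (h0 _)]
      exact h1 _
    · have hne : ∀ᵐ x : EuclideanSpace ℝ (Fin N), x ≠ x₀ := by
        have : Nonempty (Fin N) := ⟨⟨0, hN⟩⟩
        exact Measure.ae_ne volume x₀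
      filter_upwards [ae_restrict_of_ae hne] with x hx
      refine tendsto_const_nhds.congr' ?_
      filter_upwards [Ioo_mem_nhdsGT (dist_pos.2 hx)] with r hr
      rw [rescale_eq_zero hη hr.1 (fun h => lt_asymm hr.2 h), zero_mul]
  simpa using key

theorem one_lt_criticalExponent (hN : 1 ≤ N) {s : ℝ} (hs : 1 / 2 < s) (hs1 : s < 1) :
    1 < criticalExponent N s := by
  have hN' : (1 : ℝ) ≤ N := by exact_mod_cast hN
  rw [criticalExponent, one_lt_div (by linarith)]
  linarith

/-- As `N/q = N - N/p`, the claim reads `N/p < N - 2s + 1`, which is `p > p_*`. -/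
theorem scaling_exponent_pos (hN : 1 ≤ N) {s : ℝ} (hs1 : s < 1) {p q : ℝ}
    (hpq : p.HolderConjugate q) (hp : criticalExponent N s < p) :
    0 < (N : ℝ) / q + (1 - 2 * s) := by
  have hN' : (1 : ℝ) ≤ N := by exact_mod_cast hN
  rw [criticalExponent, div_lt_comm₀ (by linarith) hpq.pos] at hp
  have hq : (N : ℝ) / q = N - N / p := by
    rw [div_eq_mul_inv, div_eq_mul_inv, eq_sub_of_add_eq' hpq.inv_add_inv_eq_one]
    ring
  rw [hq]
  linarith

end FracHJ

end

theorem mainTheorem8 (N : ℕ) (hN : 1 ≤ N) (s p : ℝ) (hs : 1 / 2 < s) (hs1 : s < 1)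
    (hp : FracHJ.criticalExponent N s < p)
    (Ω : Set (EuclideanSpace ℝ (Fin N))) (hΩ : IsOpen Ω) (hΩb : Bornology.IsBounded Ω)
    (x₀ : EuclideanSpace ℝ (Fin N)) (hx₀ : x₀ ∈ Ω) :
    ¬ ∃ u : EuclideanSpace ℝ (Fin N) → ℝ,
      FracHJ.MemSobolevZero Ω p u ∧
      FracHJ.IsDistributionalSolution s p Ω (Measure.dirac x₀) u := by
  classical
  -- This `G` and the weak gradient inside `hu` need not be identified: `hu` controls only the
  -- fractional Laplacian term, `G` only the gradient term.
  rintro ⟨u, hu, hui, -, G, -, hG, hsol⟩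
  have hpq := Real.HolderConjugate.conjExponent
    ((FracHJ.one_lt_criticalExponent hN hs hs1).trans hp)
  have hγ := FracHJ.scaling_exponent_pos hN hs1 hpq hp
  obtain ⟨η, hηs, hη0, h0, h1, hη⟩ := FracHJ.exists_cutoff N
  obtain ⟨B, hB⟩ := hu.exists_abs_integral_mul_fracLaplacian_le hN hs hs1 hpq hΩb hui hηs h0 h1 hη x₀
  obtain ⟨R, hR, hRΩ⟩ := Metric.nhds_basis_closedBall.mem_iff.1 (hΩ.mem_nhds hx₀)
  have hball : ∀ᶠ r : ℝ in 𝓝[>] 0, 0 < r ∧ Metric.closedBall x₀ r ⊆ Ω := by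
    filter_upwards [Ioo_mem_nhdsGT hR] with r hr
    exact ⟨hr.1, (Metric.closedBall_subset_closedBall hr.2.le).trans hRΩ⟩
  have hpow : Tendsto (fun r : ℝ => B * r ^ ((N : ℝ) / p.conjExponent + (1 - 2 * s))) (𝓝[>] 0)
      (𝓝 0) := by
    have := ((Real.continuousAt_rpow_const 0 _ (Or.inr hγ.le)).tendsto.const_mul B).mono_left
      (nhdsWithin_le_nhds (s := Ioi (0 : ℝ)))
    rwa [Real.zero_rpow hγ.ne', mul_zero] at this
  have hlap : Tendsto (fun r => ∫ x in Ω, u x * FracHJ.fracLaplacian s (FracHJ.rescale η x₀ r) x)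
      (𝓝[>] 0) (𝓝 0) := by
    refine squeeze_zero_norm' ?_ hpow
    filter_upwards [hball] with r hr using hB r hr.1 hr.2
  have hgrad := FracHJ.tendsto_integral_rescale_mul hN hΩ hx₀ hηs.continuous h0 h1 hη hG
  have hone : ∀ᶠ r : ℝ in 𝓝[>] 0,
      (∫ x in Ω, u x * FracHJ.fracLaplacian s (FracHJ.rescale η x₀ r) x)
        + ∫ x in Ω, FracHJ.rescale η x₀ r x * ‖G x‖ ^ p = 1 := by
    filter_upwards [hball] with r hr
    -- The Dirac mass sees `η_r(x₀) = η(0) = 1`, independently of `r`.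
    rw [(hsol _ ((FracHJ.isTestFunction_rescale hηs hη hr.1 hr.2).memTestSpace hN hs hs1 hΩb)).2,
      setIntegral_dirac, if_pos hx₀, FracHJ.rescale, sub_self, smul_zero, hη0]
  have hlim := (hlap.add hgrad).congr' hone
  rw [add_zero] at hlim
  exact zero_ne_one (tendsto_nhds_unique hlim tendsto_const_nhds)
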